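/- Let $k$ be a field and let $H$ be a finite-dimensional Hopf algebra over $k$ which is pointed, i.e. every simple subcoalgebra of $H$ is one-dimensional. Let $A$ be a commutative, finitely generated (affine) $k$-algebra which is an $H$-module algebra, i.e. $A$ is a left $H$-module (compatibly with its $k$-vector space structure) such that $h(ab)=\sum (h_{(1)}a)(h_{(2)}b)$ and $h1=\varepsilon(h)1$ for all $h\in H$, $a,b\in A$, where $\Delta(h)=\sum h_{(1)}\otimes h_{(2)}$ is the comultiplication and $\varepsilon$ is the counit. Let $A^H=\{a\in A : ha=\varepsilon(h)a \text{ for all } h\in H\}$ be the subalgebra of invariants. Suppose that at least one of the following conditions holds: 1. $\operatorname{char} k=p>0$; 2. $H$ is commutative as an algebra; 3. $A$ is an integral domain. Then $A$ is integral over $A^H$. -/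

import Mathlib

open scoped TensorProduct

/-- A subspace `D` of a coalgebra `C` is a subcoalgebra if `Δ(D) ⊆ D ⊗ D`, the latter viewed
inside `C ⊗ C`. -/
def IsSubcoalgebra (k : Type*) {C : Type*} [Field k] [AddCommGroup C] [Module k C] [Coalgebra k C]
    (D : Submodule k C) : Prop :=
  D.map (Coalgebra.comul (R := k) (A := C)) ≤
    LinearMap.range (TensorProduct.map D.subtype D.subtype)

/-- A simple subcoalgebra: nonzero, with no subcoalgebras except `0` and itself. -/
structure IsSimpleSubcoalgebra (k : Type*) {C : Type*} [Field k] [AddCommGroup C] [Module k C]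
    [Coalgebra k C] (D : Submodule k C) : Prop where
  isSubcoalgebra : IsSubcoalgebra k D
  ne_bot : D ≠ ⊥
  eq_bot_or_eq : ∀ E : Submodule k C, IsSubcoalgebra k E → E ≤ D → E = ⊥ ∨ E = D

/-- A coalgebra is pointed if all of its simple subcoalgebras are one-dimensional. -/
def IsPointedCoalgebra (k : Type*) (C : Type*) [Field k] [AddCommGroup C] [Module k C]
    [Coalgebra k C] : Prop :=
  ∀ D : Submodule k C, IsSimpleSubcoalgebra k D → Module.finrank k D = 1

/-- The linear map `H ⊗ H → A`, `x ⊗ y ↦ (x • a) * (y • b)`. -/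
noncomputable def tensorAct (k : Type*) (H : Type*) {A : Type*} [Field k] [Ring H] [Algebra k H]
    [CommRing A] [Algebra k A] [Module H A] [IsScalarTower k H A] (a b : A) :
    H ⊗[k] H →ₗ[k] A :=
  LinearMap.mul' k A ∘ₗ
    TensorProduct.map ((LinearMap.toSpanSingleton H A a).restrictScalars k)
      ((LinearMap.toSpanSingleton H A b).restrictScalars k)

theorem tensorAct_tmul (k : Type*) (H : Type*) {A : Type*} [Field k] [Ring H] [Algebra k H]
    [CommRing A] [Algebra k A] [Module H A] [IsScalarTower k H A] (a b : A) (x y : H) :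
    tensorAct k H a b (x ⊗ₜ[k] y) = (x • a) * (y • b) := by
  simp [tensorAct]

/-- `A` is an `H`-module algebra: `h(ab) = ∑ (h₁ a)(h₂ b)` and `h 1 = ε(h) 1`. -/
class IsHopfModuleAlgebra (k : Type*) (H : Type*) (A : Type*) [Field k] [Ring H] [HopfAlgebra k H]
    [CommRing A] [Algebra k A] [Module H A] [IsScalarTower k H A] : Prop where
  smul_mul : ∀ (h : H) (a b : A), h • (a * b) = tensorAct k H a b (Coalgebra.comul (R := k) h)
  smul_one : ∀ h : H, h • (1 : A) = algebraMap k A (Coalgebra.counit (R := k) h)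

/-- The subalgebra `A^H` of those `a ∈ A` with `h a = ε(h) a` for all `h ∈ H`. -/
def hopfInvariants (k : Type*) (H : Type*) (A : Type*) [Field k] [Ring H] [HopfAlgebra k H]
    [CommRing A] [Algebra k A] [Module H A] [IsScalarTower k H A] [IsHopfModuleAlgebra k H A] :
    Subalgebra k A where
  carrier := {a : A | ∀ h : H, h • a = Coalgebra.counit (R := k) h • a}
  add_mem' := by
    intro a b ha hb h
    rw [smul_add, smul_add, ha h, hb h]
  mul_mem' := by
    intro a b ha hb h
    have key : tensorAct k H a b =
        (LinearMap.toSpanSingleton k A (a * b)) ∘ₗ (Coalgebra.counit (R := k) (A := H)) ∘ₗ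
          (TensorProduct.lid k H).toLinearMap ∘ₗ
            (LinearMap.rTensor H (Coalgebra.counit (R := k) (A := H))) := by
      ext x y
      simp [tensorAct, ha x, hb y, smul_smul, mul_comm]
    rw [IsHopfModuleAlgebra.smul_mul (k := k), key]
    simp
  algebraMap_mem' := by
    intro r h
    have e : algebraMap k A r = (algebraMap k H r) • (1 : A) := by
      rw [algebraMap_smul, Algebra.algebraMap_eq_smul_one]
    rw [e, smul_smul, ← Algebra.commutes, ← smul_smul, IsHopfModuleAlgebra.smul_one (k := k),
      algebraMap_smul, algebraMap_smul, Algebra.algebraMap_eq_smul_one, smul_comm]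

/-! Let `G` be the finite group of group-like elements and `B = A^G`. Since `G` acts by
automorphisms, `A` is integral over `B`, and it remains to compare `B` with `A^H`. Pointedness
enters through `eq_top_of_coalgebraWedge_le`: a subspace `V` with `kG ∧ V ⊆ V` is all of `H`.
Dually, functionals killing `kG` lie in the Jacobson radical of the dual algebra, which is
nilpotent. This criterion is mostly applied to spaces of elements acting through the counit: if `V`
acts so on a subring of `B` and `h ∈ kG ∧ V`, then `h - ε(h)` is a derivation from that subring to
`A` (`smul_mul_of_mem_coalgebraWedge`).

In characteristic `p`, derivations kill `p`-th powers, so some `p ^ N`-th power map sends `B` into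
`A^H`. In characteristic zero, `B = A^H`. For commutative `H`, elements of the wedge become, after
subtracting the counit, primitive modulo the ideal of all `g - 1`, and a finite-dimensional algebra
has no room for nonzero primitives. For a domain `A`, each `v ∈ B` satisfies a polynomial relation
whose coefficient ratios behave as constants; differentiating the relation repeatedly forces the
derivation to kill `v`. -/

/-! ### Detecting tensors by pairs of functionals -/

section TensorDual

variable {k C : Type*} [Field k] [AddCommGroup C] [Module k C]

theorem tensor_eq_zero_of_forall_dual {t : C ⊗[k] C}
    (h : ∀ f f' : C →ₗ[k] k, LinearMap.mul' k k (TensorProduct.map f f' t) = 0) : t = 0 := by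
  let b := Module.Basis.ofVectorSpace k C
  refine (b.tensorProduct b).ext_elem fun ij => ?_
  obtain ⟨i, j⟩ := ij
  have e : ((b.tensorProduct b).coord (i, j)) =
      LinearMap.mul' k k ∘ₗ TensorProduct.map (b.coord i) (b.coord j) := by
    ext x y
    simp [mul_comm]
  have := congrArg (fun φ => φ t) e
  simp only [Module.Basis.coord_apply, LinearMap.comp_apply, h] at this
  simpa using this

theorem map_sub_left_apply {D : Type*} [AddCommGroup D] [Module k D] (f f' g : C →ₗ[k] D)
    (t : C ⊗[k] C) : TensorProduct.map (f - f') g t =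
      TensorProduct.map f g t - TensorProduct.map f' g t := by
  rw [← LinearMap.sub_apply]
  congr 1
  ext x y
  simp [TensorProduct.sub_tmul]

theorem map_sub_right_apply {D : Type*} [AddCommGroup D] [Module k D] (f g g' : C →ₗ[k] D)
    (t : C ⊗[k] C) : TensorProduct.map f (g - g') t =
      TensorProduct.map f g t - TensorProduct.map f g' t := by
  rw [← LinearMap.sub_apply]
  congr 1
  ext x y
  simp [TensorProduct.tmul_sub]

theorem exists_projection_onto (U : Submodule k C) :
    ∃ e : C →ₗ[k] U, ∀ u : U, e u = u := by
  obtain ⟨e, he⟩ := LinearMap.exists_leftInverse_of_injective U.subtype (by simp)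
  exact ⟨e, fun u => congrArg (fun φ => φ u) he⟩

theorem map_subtype_comp (U : Submodule k C) (f : C →ₗ[k] U) (g : C →ₗ[k] C) (t : C ⊗[k] C) :
    TensorProduct.map (U.subtype ∘ₗ f) g t =
      TensorProduct.map U.subtype LinearMap.id (TensorProduct.map f g t) := by
  rw [← LinearMap.comp_apply, ← TensorProduct.map_comp, LinearMap.id_comp]

theorem map_comp_subtype (U : Submodule k C) (f : C →ₗ[k] U) (g : C →ₗ[k] C) (t : C ⊗[k] C) :
    TensorProduct.map g (U.subtype ∘ₗ f) t =
      TensorProduct.map LinearMap.id U.subtype (TensorProduct.map g f t) := by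
  rw [← LinearMap.comp_apply, ← TensorProduct.map_comp, LinearMap.id_comp]

/-- If all products of a functional killing `U` with one killing `V` vanish at `t`, then
`t ∈ U ⊗ C + C ⊗ V`. -/
theorem mem_range_sup_range_of_forall_dual {U V : Submodule k C} {t : C ⊗[k] C}
    (h : ∀ f f' : C →ₗ[k] k, (∀ u ∈ U, f u = 0) → (∀ v ∈ V, f' v = 0) →
      LinearMap.mul' k k (TensorProduct.map f f' t) = 0) :
    t ∈ LinearMap.range (TensorProduct.map U.subtype (LinearMap.id (R := k) (M := C))) ⊔
      LinearMap.range (TensorProduct.map (LinearMap.id (R := k) (M := C)) V.subtype) := by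
  obtain ⟨p, hp⟩ := exists_projection_onto U
  obtain ⟨q, hq⟩ := exists_projection_onto V
  have key : TensorProduct.map (LinearMap.id - U.subtype ∘ₗ p) (LinearMap.id - V.subtype ∘ₗ q) t
      = 0 := by
    refine tensor_eq_zero_of_forall_dual fun f f' => ?_
    rw [← LinearMap.comp_apply (TensorProduct.map f f'), ← TensorProduct.map_comp]
    refine h _ _ (fun u hu => ?_) (fun v hv => ?_)
    · simp [show p u = ⟨u, hu⟩ from hp ⟨u, hu⟩]
    · simp [show q v = ⟨v, hv⟩ from hq ⟨v, hv⟩]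
  -- Expand `1 ⊗ 1 = p ⊗ 1 + (1 - p) ⊗ q + (1 - p) ⊗ (1 - q)`; the last term kills `t` by `key`.
  have e : t = TensorProduct.map (U.subtype ∘ₗ p) LinearMap.id t +
      TensorProduct.map (LinearMap.id - U.subtype ∘ₗ p) (V.subtype ∘ₗ q) t := by
    rw [map_sub_right_apply, sub_eq_zero] at key
    rw [← key, ← LinearMap.add_apply, ← TensorProduct.map_add_left]
    simp
  rw [e, map_subtype_comp, map_comp_subtype]
  exact Submodule.add_mem_sup ⟨_, rfl⟩ ⟨_, rfl⟩

/-- If a product of two functionals vanishes at `t` as soon as one of them kills `U`, then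
`t ∈ U ⊗ U`. -/
theorem mem_range_map_subtype_of_forall_dual {U : Submodule k C} {t : C ⊗[k] C}
    (h : ∀ f f' : C →ₗ[k] k, (∀ u ∈ U, f u = 0) ∨ (∀ u ∈ U, f' u = 0) →
      LinearMap.mul' k k (TensorProduct.map f f' t) = 0) :
    t ∈ LinearMap.range (TensorProduct.map U.subtype U.subtype) := by
  obtain ⟨p, hp⟩ := exists_projection_onto U
  have h1 : TensorProduct.map (LinearMap.id - U.subtype ∘ₗ p) LinearMap.id t = 0 := by
    refine tensor_eq_zero_of_forall_dual fun f f' => ?_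
    rw [← LinearMap.comp_apply (TensorProduct.map f f'), ← TensorProduct.map_comp]
    refine h _ _ (Or.inl fun u hu => ?_)
    simp [show p u = ⟨u, hu⟩ from hp ⟨u, hu⟩]
  have h2 : TensorProduct.map (U.subtype ∘ₗ p) (LinearMap.id - U.subtype ∘ₗ p) t = 0 := by
    refine tensor_eq_zero_of_forall_dual fun f f' => ?_
    rw [← LinearMap.comp_apply (TensorProduct.map f f'), ← TensorProduct.map_comp]
    refine h _ _ (Or.inr fun u hu => ?_)
    simp [show p u = ⟨u, hu⟩ from hp ⟨u, hu⟩]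
  rw [map_sub_left_apply, sub_eq_zero, TensorProduct.map_id] at h1
  rw [map_sub_right_apply, sub_eq_zero, ← h1] at h2
  refine ⟨TensorProduct.map p p t, ?_⟩
  rw [← LinearMap.comp_apply, ← TensorProduct.map_comp, ← h2, LinearMap.id_apply]

instance [FiniteDimensional k C] : FiniteDimensional k (WithConv (C →ₗ[k] k)) :=
  Module.Finite.equiv (WithConv.linearEquiv k (C →ₗ[k] k)).symm

/-- A functional outside a subspace is separated from it by a vector. -/
theorem exists_eval_ne_zero_of_notMem [FiniteDimensional k C]
    (W : Submodule k (WithConv (C →ₗ[k] k)))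
    {f : WithConv (C →ₗ[k] k)} (hf : f ∉ W) : ∃ c : C, (∀ w ∈ W, w c = 0) ∧ f c ≠ 0 := by
  by_contra! hcon
  let W' : Subspace k (Module.Dual k C) :=
    W.map (WithConv.linearEquiv k (C →ₗ[k] k)).toLinearMap
  have h : f.ofConv ∈ W'.dualCoannihilator.dualAnnihilator := by
    rw [Submodule.mem_dualAnnihilator]
    intro c hc
    rw [Submodule.mem_dualCoannihilator] at hc
    exact hcon c fun w hw => hc w.ofConv (Submodule.mem_map_of_mem hw)
  rw [Subspace.dualCoannihilator_dualAnnihilator_eq] at h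
  obtain ⟨w, hw, hwf⟩ := h
  exact hf ((WithConv.linearEquiv k (C →ₗ[k] k)).injective hwf ▸ hw)

end TensorDual

/-! ### Pointed coalgebras: wedges and the radical of the dual algebra -/

section Wedge

variable {k C : Type*} [Field k] [AddCommGroup C] [Module k C] [Coalgebra k C]

variable (k C) in
/-- The span of the group-like elements. -/
def groupLikeSpan : Submodule k C := Submodule.span k {g | IsGroupLikeElem k g}

/-- The wedge `U ∧ V = {c : Δ(c) ∈ U ⊗ C + C ⊗ V}`. -/
noncomputable def coalgebraWedge (U V : Submodule k C) : Submodule k C :=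
  (LinearMap.range (TensorProduct.map U.subtype (LinearMap.id (R := k) (M := C))) ⊔
    LinearMap.range (TensorProduct.map (LinearMap.id (R := k) (M := C)) V.subtype)).comap
      Coalgebra.comul

/-- Two linear maps agree at `Δ(c)`, `c ∈ U ∧ V`, if they agree on `U ⊗ C` and `C ⊗ V`. -/
theorem eq_of_mem_coalgebraWedge {M : Type*} [AddCommGroup M] [Module k M]
    {U V : Submodule k C} {c : C} (hc : c ∈ coalgebraWedge U V) (φ ψ : C ⊗[k] C →ₗ[k] M)
    (hU : ∀ u ∈ U, ∀ y, φ (u ⊗ₜ y) = ψ (u ⊗ₜ y)) (hV : ∀ x, ∀ v ∈ V, φ (x ⊗ₜ v) = ψ (x ⊗ₜ v)) :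
    φ (Coalgebra.comul c) = ψ (Coalgebra.comul c) := by
  have hle : LinearMap.range (TensorProduct.map U.subtype (LinearMap.id (R := k) (M := C))) ⊔
      LinearMap.range (TensorProduct.map (LinearMap.id (R := k) (M := C)) V.subtype) ≤
        LinearMap.eqLocus φ ψ := by
    refine sup_le ?_ ?_
    · rintro _ ⟨t, rfl⟩
      have : φ ∘ₗ TensorProduct.map U.subtype LinearMap.id =
          ψ ∘ₗ TensorProduct.map U.subtype LinearMap.id :=
        TensorProduct.ext' fun x y => hU x x.2 y
      exact congrArg (fun χ => χ t) this
    · rintro _ ⟨t, rfl⟩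
      have : φ ∘ₗ TensorProduct.map LinearMap.id V.subtype =
          ψ ∘ₗ TensorProduct.map LinearMap.id V.subtype :=
        TensorProduct.ext' fun x y => hV x y y.2
      exact congrArg (fun χ => χ t) this
  exact hle hc

variable [FiniteDimensional k C]

/-- In a finite-dimensional pointed coalgebra, every nonzero subcoalgebra contains a group-like
element. -/
theorem exists_isGroupLikeElem_mem (hC : IsPointedCoalgebra k C) {D : Submodule k C}
    (hD : IsSubcoalgebra k D) (hD0 : D ≠ ⊥) : ∃ g ∈ D, IsGroupLikeElem k g := by
  obtain ⟨E, ⟨hE, hED, hE0⟩, hmin⟩ := exists_minimal_of_wellFoundedLT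
    (fun E : Submodule k C => IsSubcoalgebra k E ∧ E ≤ D ∧ E ≠ ⊥) ⟨D, hD, le_rfl, hD0⟩
  have hsimple : IsSimpleSubcoalgebra k E := by
    refine ⟨hE, hE0, fun F hF hFE => ?_⟩
    by_cases hF0 : F = ⊥
    · exact Or.inl hF0
    · exact Or.inr (le_antisymm hFE (hmin ⟨hF, hFE.trans hED, hF0⟩ hFE))
  obtain ⟨x, hx0, hx⟩ := finrank_eq_one_iff'.1 (hC E hsimple)
  have hrange : ∀ t : E ⊗[k] E, ∃ c : k,
      TensorProduct.map E.subtype E.subtype t = c • ((x : C) ⊗ₜ[k] (x : C)) := by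
    intro t
    induction t with
    | zero => exact ⟨0, by simp⟩
    | tmul y z =>
      obtain ⟨a, rfl⟩ := hx y
      obtain ⟨b, rfl⟩ := hx z
      exact ⟨b * a, by simp [TensorProduct.smul_tmul', TensorProduct.tmul_smul, smul_smul]⟩
    | add t u ht hu =>
      obtain ⟨a, ha⟩ := ht
      obtain ⟨b, hb⟩ := hu
      exact ⟨a + b, by rw [map_add, ha, hb, add_smul]⟩
  obtain ⟨t, ht⟩ := hE (Submodule.mem_map_of_mem x.2)
  obtain ⟨c, hc⟩ := hrange t
  rw [ht] at hc
  have hcx : (x : C) = (c * Coalgebra.counit (R := k) (x : C)) • (x : C) := by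
    have := Coalgebra.rTensor_counit_comul (R := k) (x : C)
    rw [hc] at this
    have := congrArg (TensorProduct.lid k C) this
    simpa [smul_smul] using this.symm
  have hx0' : (x : C) ≠ 0 := by simpa using hx0
  have hc1 : c * Coalgebra.counit (R := k) (x : C) = 1 := by
    refine smul_left_injective k hx0' ?_
    simpa using hcx.symm
  -- From `Δ(x) = c • x ⊗ x` and `c * ε(x) = 1`, the multiple `c • x` is group-like.
  refine ⟨c • (x : C), hED (E.smul_mem c x.2), ⟨by simpa using hc1, ?_⟩⟩
  rw [map_smul, hc, TensorProduct.smul_tmul', TensorProduct.tmul_smul, TensorProduct.smul_tmul',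
    smul_smul]

/-- An element killed by every homomorphism onto a simple ring lies in the Jacobson radical. -/
theorem mem_jacobson_of_forall_simple.{u} {R : Type u} [Ring R] [IsArtinianRing R] {x : R}
    (hx : ∀ (S : Type u) [Ring S] [IsSimpleRing S] (π : R →+* S), Function.Surjective π → π x = 0) :
    x ∈ Ring.jacobson R := by
  obtain ⟨n, D, d, _, hd, ⟨e⟩⟩ :=
    IsSemisimpleRing.exists_ringEquiv_pi_matrix_divisionRing (R ⧸ Ring.jacobson R)
  rw [← Ideal.Quotient.eq_zero_iff_mem, ← e.map_eq_zero_iff]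
  funext i
  have := hd i
  exact hx (Matrix (Fin (d i)) (Fin (d i)) (D i))
    (((Pi.evalRingHom _ i).comp e.toRingHom).comp (Ideal.Quotient.mk _))
    (((Function.surjective_eval i).comp e.surjective).comp Ideal.Quotient.mk_surjective)

/-- Evaluation at a group-like element is a homomorphism on the dual algebra. -/
noncomputable def dualEval {g : C} (hg : IsGroupLikeElem k g) : WithConv (C →ₗ[k] k) →+* k where
  toFun f := f g
  map_one' := by simp [hg.counit_eq_one]
  map_mul' f f' := by simp [hg.comul_eq_tmul_self]
  map_zero' := rfl
  map_add' _ _ := rfl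

instance : IsArtinianRing (WithConv (C →ₗ[k] k)) := IsArtinianRing.of_finite k _

/-- A functional killing all group-like elements of a pointed coalgebra lies in the radical of the
dual algebra. -/
theorem mem_jacobson_of_isPointedCoalgebra (hC : IsPointedCoalgebra k C)
    {f : WithConv (C →ₗ[k] k)} (hf : ∀ g : C, IsGroupLikeElem k g → f g = 0) :
    f ∈ Ring.jacobson (WithConv (C →ₗ[k] k)) := by
  refine mem_jacobson_of_forall_simple fun S _ _ π hπ => ?_
  -- The annihilator `D` of the two-sided ideal `ker π` is a subcoalgebra, nonzero because `1 ∉ ker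
  -- π`.
  let P : Submodule k (WithConv (C →ₗ[k] k)) := (RingHom.ker π).restrictScalars k
  let D : Submodule k C :=
    { carrier := {c | ∀ p ∈ P, p c = 0}
      add_mem' := fun {a b} ha hb p hp => by
        change p.ofConv (a + b) = 0
        rw [map_add]
        exact (congrArg₂ (· + ·) (ha p hp) (hb p hp)).trans (add_zero 0)
      zero_mem' := fun p _ => map_zero p.ofConv
      smul_mem' := fun r a ha p hp => by
        change p.ofConv (r • a) = 0
        rw [map_smul]
        exact (congrArg (r • ·) (ha p hp)).trans (smul_zero r) }
  have hperp : ∀ p : WithConv (C →ₗ[k] k), (∀ c ∈ D, p c = 0) → p ∈ P := by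
    intro p hp
    by_contra hpP
    obtain ⟨c, hc, hpc⟩ := exists_eval_ne_zero_of_notMem P hpP
    exact hpc (hp c hc)
  have hD : IsSubcoalgebra k D := by
    rintro _ ⟨c, hc, rfl⟩
    refine mem_range_map_subtype_of_forall_dual fun p p' hpp' => ?_
    rcases hpp' with hp | hp
    · refine hc (WithConv.toConv p * WithConv.toConv p') ?_
      change π _ = 0
      rw [map_mul, show π (WithConv.toConv p) = 0 from hperp (WithConv.toConv p) hp, zero_mul]
    · refine hc (WithConv.toConv p * WithConv.toConv p') ?_
      change π _ = 0
      rw [map_mul, show π (WithConv.toConv p') = 0 from hperp (WithConv.toConv p') hp, mul_zero]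
  have hD0 : D ≠ ⊥ := by
    intro h
    have h1 : (1 : WithConv (C →ₗ[k] k)) ∈ P := hperp 1 fun c hc => by
      rw [h, Submodule.mem_bot] at hc
      simp [hc]
    exact one_ne_zero ((map_one π).symm.trans h1)
  obtain ⟨g, hgD, hg⟩ := exists_isGroupLikeElem_mem hC hD hD0
  obtain ⟨σ, hσ⟩ := hπ.hasRightInverse
  -- Evaluation at `g ∈ D` kills `ker π`, so it factors through `S`; simplicity of `S` makes the
  -- factor `χ` injective.
  let χ : S →+* k := RingHom.liftOfRightInverse π σ hσ ⟨dualEval hg, fun p hp => hgD p hp⟩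
  have hχ : χ (π f) = dualEval hg f :=
    RingHom.liftOfRightInverse_comp_apply π σ hσ ⟨dualEval hg, fun p hp => hgD p hp⟩ f
  refine χ.injective ?_
  rw [hχ, map_zero]
  exact hf g hg

/-- A pointed coalgebra is exhausted by iterated wedges with the span of its group-likes. -/
theorem eq_top_of_coalgebraWedge_le (hC : IsPointedCoalgebra k C) {V : Submodule k C}
    (hV : coalgebraWedge (groupLikeSpan k C) V ≤ V) : V = ⊤ := by
  let W : Submodule k (WithConv (C →ₗ[k] k)) :=
    V.dualAnnihilator.map (WithConv.linearEquiv k (C →ₗ[k] k)).symm.toLinearMap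
  have memW : ∀ f : WithConv (C →ₗ[k] k), f ∈ W ↔ ∀ v ∈ V, f v = 0 := by
    intro f
    constructor
    · rintro ⟨f', hf', rfl⟩
      exact (Submodule.mem_dualAnnihilator f').1 hf'
    · intro h
      exact ⟨f.ofConv, (Submodule.mem_dualAnnihilator f.ofConv).2 h, rfl⟩
  -- If `J ^ (n + 1)` kills `c`, then so do all products of a functional killing `kG` (in `J`) with
  -- one killing `V` (in `J ^ n` by induction). Hence `c ∈ kG ∧ V ⊆ V`, and `f` kills `c`.
  have hstep : ∀ n : ℕ, ∀ f ∈ W, f ∈ Ring.jacobson (WithConv (C →ₗ[k] k)) ^ n := by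
    intro n
    induction n with
    | zero => intro f _; rw [Submodule.pow_zero, Ideal.one_eq_top]; trivial
    | succ n ih =>
      intro f hf
      by_contra hfJ
      obtain ⟨c, hc, hfc⟩ := exists_eval_ne_zero_of_notMem
        ((Ring.jacobson (WithConv (C →ₗ[k] k)) ^ (n + 1)).restrictScalars k) hfJ
      refine hfc ((memW f).1 hf c (hV ?_))
      refine mem_range_sup_range_of_forall_dual fun p p' hp hp' => ?_
      refine hc (WithConv.toConv p * WithConv.toConv p') ?_
      change _ ∈ Ring.jacobson (WithConv (C →ₗ[k] k)) ^ (n + 1)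
      rw [Ideal.IsTwoSided.pow_succ]
      refine Ideal.mul_mem_mul ?_ (ih _ ((memW _).2 hp'))
      exact mem_jacobson_of_isPointedCoalgebra hC fun g hg => hp g (Submodule.subset_span hg)
  obtain ⟨n, hn⟩ := IsSemiprimaryRing.isNilpotent (R := WithConv (C →ₗ[k] k))
  have hbot : V.dualAnnihilator = ⊥ := by
    rw [eq_bot_iff]
    intro f hf
    have h := hstep n (WithConv.toConv f) ⟨f, hf, rfl⟩
    rw [hn] at h
    exact congrArg WithConv.ofConv (show WithConv.toConv f = 0 from h)
  rw [← Subspace.dualAnnihilator_dualCoannihilator_eq (W := V), hbot,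
    Submodule.dualCoannihilator_bot]

end Wedge

/-! ### Actions of group-likes and wedges; positive characteristic -/

theorem smul_scalar_smul {k H A : Type*} [Field k] [Ring H] [Algebra k H]
    [CommRing A] [Algebra k A] [Module H A] [IsScalarTower k H A] (h : H) (c : k)
    (a : A) : h • (c • a) = c • (h • a) := by
  rw [← algebraMap_smul H c a, smul_smul, ← Algebra.commutes, ← smul_smul, algebraMap_smul]

section Action

variable {k H A : Type*} [Field k] [Ring H] [HopfAlgebra k H] [CommRing A] [Algebra k A]
  [Module H A] [IsScalarTower k H A] [IsHopfModuleAlgebra k H A]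

theorem IsGroupLikeElem.smul_mul {g : H} (hg : IsGroupLikeElem k g) (a b : A) :
    g • (a * b) = (g • a) * (g • b) := by
  rw [IsHopfModuleAlgebra.smul_mul (k := k), hg.comul_eq_tmul_self, tensorAct_tmul]

theorem IsGroupLikeElem.smul_one {g : H} (hg : IsGroupLikeElem k g) : g • (1 : A) = 1 := by
  rw [IsHopfModuleAlgebra.smul_one (k := k), hg.counit_eq_one, map_one]

variable (k H A) in
/-- The action of the group of group-like elements by algebra automorphisms. -/
@[reducible] def groupLikeAction : MulSemiringAction (GroupLike k H) A where
  smul g a := (g : H) • a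
  one_smul a := one_smul H a
  mul_smul g g' a := mul_smul (g : H) (g' : H) a
  smul_zero g := _root_.smul_zero (g : H)
  smul_add g a b := _root_.smul_add (g : H) a b
  smul_one g := g.2.smul_one
  smul_mul g a b := g.2.smul_mul a b

variable (k H A) in
/-- The subalgebra of elements fixed by all group-like elements. -/
def groupLikeInvariants : Subalgebra k A where
  carrier := {a | ∀ g : H, IsGroupLikeElem k g → g • a = a}
  add_mem' ha hb g hg := by rw [_root_.smul_add, ha g hg, hb g hg]
  mul_mem' ha hb g hg := by rw [hg.smul_mul, ha g hg, hb g hg]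
  algebraMap_mem' c g hg := by
    rw [Algebra.algebraMap_eq_smul_one, smul_scalar_smul, hg.smul_one]

theorem smul_eq_counit_smul_of_mem_groupLikeSpan {a : A} (ha : a ∈ groupLikeInvariants k H A)
    {u : H} (hu : u ∈ groupLikeSpan k H) : u • a = Coalgebra.counit (R := k) u • a := by
  induction hu using Submodule.span_induction with
  | mem g hg => rw [ha g hg, hg.counit_eq_one, one_smul]
  | zero => simp
  | add x y _ _ hx hy => rw [add_smul, hx, hy, map_add, add_smul]
  | smul c x _ hx => rw [smul_assoc, hx, map_smul, smul_assoc]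

/-- On elements that `U` resp. `V` fix, `U ∧ V` acts by derivations, up to the counit. -/
theorem smul_mul_of_mem_coalgebraWedge {U V : Submodule k H} {a b : A}
    (ha : ∀ u ∈ U, u • a = Coalgebra.counit (R := k) u • a)
    (hb : ∀ v ∈ V, v • b = Coalgebra.counit (R := k) v • b)
    {h : H} (hh : h ∈ coalgebraWedge U V) :
    h • (a * b) = a * (h • b) + b * (h • a) - Coalgebra.counit (R := k) h • (a * b) := by
  -- The two maps differ by `x ⊗ y ↦ (x a - ε(x) a) (y b - ε(y) b)`, which vanishes once `x ∈ U` or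
  -- `y ∈ V`.
  have key := eq_of_mem_coalgebraWedge hh (tensorAct k H a b)
    (LinearMap.mulLeft k a ∘ₗ tensorAct k H 1 b + LinearMap.mulLeft k b ∘ₗ tensorAct k H a 1 -
      LinearMap.mulLeft k (a * b) ∘ₗ tensorAct k H 1 1) ?_ ?_
  · simp only [LinearMap.sub_apply, LinearMap.add_apply, LinearMap.comp_apply,
      LinearMap.mulLeft_apply, ← IsHopfModuleAlgebra.smul_mul, one_mul, mul_one,
      IsHopfModuleAlgebra.smul_one (k := k)] at key
    rw [key, Algebra.smul_def (Coalgebra.counit h) (a * b), mul_comm (algebraMap k A _)]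
  · intro u hu y
    simp only [LinearMap.sub_apply, LinearMap.add_apply, LinearMap.comp_apply,
      LinearMap.mulLeft_apply, tensorAct_tmul, ha u hu, IsHopfModuleAlgebra.smul_one (k := k),
      Algebra.smul_def (Coalgebra.counit u) a]
    ring
  · intro x v hv
    simp only [LinearMap.sub_apply, LinearMap.add_apply, LinearMap.comp_apply,
      LinearMap.mulLeft_apply, tensorAct_tmul, hb v hv, IsHopfModuleAlgebra.smul_one (k := k),
      Algebra.smul_def (Coalgebra.counit v) b]
    ring

/-- Power rule for the derivation `h - ε(h)`. The factor `n + 1` is what vanishes in characteristic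
`p` for the exponent `n + 1 = p`. -/
theorem smul_pow_of_mem_coalgebraWedge {U V : Submodule k H} {a : A}
    (ha : ∀ u ∈ U, u • a = Coalgebra.counit (R := k) u • a)
    (hb : ∀ n : ℕ, ∀ v ∈ V, v • a ^ n = Coalgebra.counit (R := k) v • a ^ n)
    {h : H} (hh : h ∈ coalgebraWedge U V) (n : ℕ) :
    h • a ^ (n + 1) = Coalgebra.counit (R := k) h • a ^ (n + 1) +
      (n + 1 : A) * a ^ n * (h • a - Coalgebra.counit (R := k) h • a) := by
  induction n with
  | zero => simp
  | succ n ih =>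
    rw [pow_succ' a (n + 1), smul_mul_of_mem_coalgebraWedge ha (hb (n + 1)) hh, ih]
    simp only [Algebra.smul_def]
    push_cast
    ring

variable (k H A) in
theorem isIntegral_groupLikeInvariants [FiniteDimensional k H] :
    Algebra.IsIntegral (groupLikeInvariants k H A) A := by
  let _ := groupLikeAction k H A
  have : Finite (GroupLike k H) :=
    (linearIndep_groupLikeVal (R := k) (A := H)).finite
  have : SMulCommClass (GroupLike k H) (groupLikeInvariants k H A) A :=
    ⟨fun g c a => by
      change g.val • ((c : A) * a) = (c : A) * (g.val • a)
      rw [g.2.smul_mul, c.2 g.val g.2]⟩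
  have : Algebra.IsInvariant (groupLikeInvariants k H A) A (GroupLike k H) :=
    ⟨fun a ha => ⟨⟨a, fun g hg => ha ⟨g, hg⟩⟩, rfl⟩⟩
  exact Algebra.IsInvariant.isIntegral _ _ (GroupLike k H)

theorem hopfInvariants_le_groupLikeInvariants :
    hopfInvariants k H A ≤ groupLikeInvariants k H A := fun a ha g hg => by
  rw [ha g, hg.counit_eq_one, one_smul]

/-- Each `a ∈ A^G` is a root of `X ^ q - a ^ q`, so integrality passes up the tower `A^H ⊆ A^G ⊆ A`.
-/
theorem isIntegral_hopfInvariants_of_pow_mem [FiniteDimensional k H] {q : ℕ} (hq : 0 < q)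
    (hpow : ∀ a ∈ groupLikeInvariants k H A, a ^ q ∈ hopfInvariants k H A) :
    Algebra.IsIntegral (hopfInvariants k H A) A := by
  let f : hopfInvariants k H A →+* groupLikeInvariants k H A :=
    (Subalgebra.inclusion hopfInvariants_le_groupLikeInvariants).toRingHom
  have hf : f.IsIntegral := fun a =>
    ⟨Polynomial.X ^ q - Polynomial.C ⟨(a : A) ^ q, hpow a a.2⟩,
      Polynomial.monic_X_pow_sub_C _ hq.ne', by
        ext
        simp [f]⟩
  have hg : (algebraMap (groupLikeInvariants k H A) A).IsIntegral :=
    (isIntegral_groupLikeInvariants k H A).isIntegral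
  exact ⟨(RingHom.IsIntegral.trans f _ hf hg :)⟩

theorem isIntegral_hopfInvariants_of_le [FiniteDimensional k H]
    (hle : groupLikeInvariants k H A ≤ hopfInvariants k H A) :
    Algebra.IsIntegral (hopfInvariants k H A) A :=
  isIntegral_hopfInvariants_of_pow_mem one_pos fun a ha => by simpa using hle ha

/-- The subspace of those `h` that act through the counit on all elements of `S`. -/
def trivialActors (k : Type*) (H : Type*) {A : Type*} [Field k] [Ring H] [HopfAlgebra k H]
    [CommRing A] [Algebra k A] [Module H A] [IsScalarTower k H A] (S : Set A) :
    Submodule k H where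
  carrier := {h | ∀ a ∈ S, h • a = Coalgebra.counit (R := k) h • a}
  add_mem' hx hy a ha := by rw [add_smul, hx a ha, hy a ha, map_add, add_smul]
  zero_mem' a _ := by simp
  smul_mem' c x hx a ha := by rw [smul_assoc, hx a ha, map_smul, smul_assoc]

/-- Let `V n` act through the counit on all `p ^ n`-th powers from `A^G`. The power rule gives `kG ∧
V n ⊆ V (n + 1)`; the increasing chain stabilizes, and its limit is closed under the wedge, hence
equals `H`. -/
theorem isIntegral_hopfInvariants_of_charP [FiniteDimensional k H] (hH : IsPointedCoalgebra k H)
    {p : ℕ} (hp : 0 < p) [CharP k p] : Algebra.IsIntegral (hopfInvariants k H A) A := by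
  let V : ℕ → Submodule k H := fun n =>
    trivialActors k H ((fun a : A => a ^ p ^ n) '' (groupLikeInvariants k H A : Set A))
  have hwedge : ∀ n, coalgebraWedge (groupLikeSpan k H) (V n) ≤ V (n + 1) := by
    rintro n h hh _ ⟨a, ha, rfl⟩
    have hmem : ∀ m : ℕ, a ^ m ∈ groupLikeInvariants k H A := fun m => pow_mem ha m
    have hpow : ∀ m : ℕ, ∀ v ∈ V n,
        v • (a ^ p ^ n) ^ m = Coalgebra.counit (R := k) v • (a ^ p ^ n) ^ m :=
      fun m v hv => hv _ ⟨a ^ m, hmem m, by simp only [← pow_mul, mul_comm]⟩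
    have key := smul_pow_of_mem_coalgebraWedge (a := a ^ p ^ n)
      (fun u hu => smul_eq_counit_smul_of_mem_groupLikeSpan (hmem _) hu) hpow hh (p - 1)
    have hp1 : ((p - 1 : ℕ) : A) + 1 = 0 := by
      rw [← Nat.cast_add_one, Nat.sub_add_cancel hp, ← map_natCast (algebraMap k A),
        CharP.cast_eq_zero, map_zero]
    rw [hp1, Nat.sub_add_cancel hp, ← pow_mul, ← pow_succ] at key
    simpa using key
  have hmono : Monotone V := by
    refine monotone_nat_of_le_succ ?_
    rintro n h hh _ ⟨a, ha, rfl⟩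
    exact hh _ ⟨a ^ p, pow_mem ha p, by simp only [← pow_mul, pow_succ']⟩
  obtain ⟨N, hN⟩ := monotone_stabilizes_iff_noetherian.2 (inferInstance : IsNoetherian k H)
    ⟨V, hmono⟩
  have htop : V N = ⊤ := eq_top_of_coalgebraWedge_le hH
    ((hwedge N).trans (hN (N + 1) N.le_succ).ge)
  refine isIntegral_hopfInvariants_of_pow_mem (q := p ^ N) (pow_pos hp N) fun a ha h => ?_
  have : h ∈ V N := htop ▸ Submodule.mem_top
  exact this _ ⟨a, ha, rfl⟩

end Action

/-! ### Commutative Hopf algebras in characteristic zero -/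

section CommutativeHopf

/-- In characteristic zero, a finite-dimensional algebra contains no nonscalar element `z` for which
`z ⊗ 1 + 1 ⊗ z` satisfies the minimal polynomial of `z`. -/
theorem mem_range_algebraMap_of_aeval_primitive_eq_zero {k B : Type*} [Field k] [CharZero k]
    [CommRing B] [Algebra k B] [FiniteDimensional k B] {z : B}
    (hz : Polynomial.aeval (z ⊗ₜ[k] (1 : B) + (1 : B) ⊗ₜ[k] z) (minpoly k z) = 0) :
    z ∈ (algebraMap k B).range := by
  have hint : IsIntegral k z := Algebra.IsIntegral.isIntegral z
  by_contra hrange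
  obtain h | _ := subsingleton_or_nontrivial B
  · exact hrange ⟨0, Subsingleton.elim _ _⟩
  set P := minpoly k z with hP
  have hdeg : 2 ≤ P.natDegree := (minpoly.two_le_natDegree_iff hint).2 hrange
  -- `φ` reads off the coefficient of `z` among the independent powers below the degree of `P`; `id
  -- ⊗ φ` then acts like differentiation.
  obtain ⟨φ, hφ⟩ : ∃ φ : B →ₗ[k] k, ∀ i : Fin P.natDegree,
      φ (z ^ (i : ℕ)) = if (i : ℕ) = 1 then 1 else 0 := by
    have hli : LinearIndependent k (fun i : Fin P.natDegree => z ^ (i : ℕ)) :=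
      linearIndependent_pow z
    obtain ⟨φ, hφ⟩ := LinearMap.exists_extend
      ((Module.Basis.span hli).constr k
        fun i : Fin P.natDegree => if (i : ℕ) = 1 then (1 : k) else 0)
    refine ⟨φ, fun i => ?_⟩
    have h1 := congrArg (fun χ => χ ((Module.Basis.span hli) i)) hφ
    simp only [LinearMap.comp_apply, Module.Basis.constr_basis, Submodule.subtype_apply] at h1
    rwa [Module.Basis.span_apply] at h1
  let ψ : B ⊗[k] B →ₗ[k] B := (TensorProduct.rid k B).toLinearMap ∘ₗ LinearMap.lTensor B φ
  have hψ : ∀ n : ℕ, ψ ((z ⊗ₜ[k] (1 : B) + (1 : B) ⊗ₜ[k] z) ^ n) =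
      ∑ i ∈ Finset.range (n + 1), (n.choose i * φ (z ^ i) : k) • z ^ (n - i) := by
    intro n
    rw [add_comm, add_pow, map_sum]
    refine Finset.sum_congr rfl fun i _ => ?_
    rw [Algebra.TensorProduct.tmul_pow, Algebra.TensorProduct.tmul_pow,
      Algebra.TensorProduct.tmul_mul_tmul, one_pow, one_pow, one_mul, mul_one, mul_comm,
      ← nsmul_eq_mul, map_nsmul]
    simp [ψ, mul_smul, ← Nat.cast_smul_eq_nsmul k]
  have hlow : ∀ n < P.natDegree, ψ ((z ⊗ₜ[k] (1 : B) + (1 : B) ⊗ₜ[k] z) ^ n) =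
      (n : k) • z ^ (n - 1) := by
    intro n hn
    rw [hψ, Finset.sum_eq_single 1]
    · rw [hφ ⟨1, hdeg⟩]
      simp
    · intro i hi hi1
      rw [hφ ⟨i, by rw [Finset.mem_range] at hi; omega⟩]
      simp [hi1]
    · intro h1
      obtain rfl : n = 0 := by simpa using h1
      simp
  have htop : ψ ((z ⊗ₜ[k] (1 : B) + (1 : B) ⊗ₜ[k] z) ^ P.natDegree) =
      (P.natDegree : k) • z ^ (P.natDegree - 1) + algebraMap k B (φ (z ^ P.natDegree)) := by
    rw [hψ, Finset.sum_range_succ, Finset.sum_eq_single 1]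
    · rw [hφ ⟨1, hdeg⟩]
      simp [Algebra.algebraMap_eq_smul_one]
    · intro i hi hi1
      rw [hφ ⟨i, Finset.mem_range.1 hi⟩]
      simp [hi1]
    · intro h1
      exact absurd (Finset.mem_range.2 hdeg) h1
  -- Applying `id ⊗ φ` to `P(z ⊗ 1 + 1 ⊗ z) = 0` yields `P'(z)` plus a constant from the top power.
  -- In characteristic zero this relation is nonzero of degree below the minimal one.
  let Q : Polynomial k := Polynomial.derivative P + Polynomial.C (φ (z ^ P.natDegree))
  have hQ : Polynomial.aeval z Q = 0 := by
    have h0 := congrArg ψ hz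
    rw [Polynomial.aeval_eq_sum_range, map_sum, map_zero, Finset.sum_range_succ, map_smul, htop,
      show P.coeff P.natDegree = 1 from minpoly.monic hint, one_smul] at h0
    rw [map_add, Polynomial.aeval_C, ← h0, ← add_assoc]
    congr 1
    rw [Polynomial.derivative_apply, Polynomial.sum_over_range _ (by simp), map_sum,
      Finset.sum_range_succ, show P.coeff P.natDegree = 1 from minpoly.monic hint]
    congr 1
    · refine Finset.sum_congr rfl fun n hn => ?_
      rw [map_smul, hlow n (Finset.mem_range.1 hn), smul_smul]
      simp [Algebra.smul_def]
    · simp [Algebra.smul_def]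
  have hQdeg : Q.natDegree = P.natDegree - 1 := by
    rw [Polynomial.natDegree_add_C]
    exact Polynomial.natDegree_eq_of_degree_eq_some (Polynomial.degree_derivative (by omega))
  have hQ0 : Q ≠ 0 := by
    intro h
    rw [h, Polynomial.natDegree_zero] at hQdeg
    omega
  have : P.natDegree ≤ Q.natDegree :=
    Polynomial.natDegree_le_natDegree (minpoly.degree_le_of_ne_zero k z hQ0 hQ)
  omega

/-- A finite-dimensional commutative pointed Hopf algebra in characteristic zero is spanned, modulo
the ideal generated by all `g - 1`, by the unit. -/
theorem sub_counit_mem_span {k H : Type*} [Field k] [CharZero k] [CommRing H] [HopfAlgebra k H]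
    [FiniteDimensional k H] (hH : IsPointedCoalgebra k H) (h : H) :
    h - algebraMap k H (Coalgebra.counit h) ∈
      Ideal.span ((fun g : H => g - 1) '' {g | IsGroupLikeElem k g}) := by
  set I : Ideal H := Ideal.span ((fun g : H => g - 1) '' {g | IsGroupLikeElem k g}) with hI
  let π : H →ₐ[k] H ⧸ I := Ideal.Quotient.mkₐ k I
  have hπ : ∀ x, π x = 0 ↔ x ∈ I := fun x => Ideal.Quotient.eq_zero_iff_mem
  have hg : ∀ g : H, IsGroupLikeElem k g → π g = 1 := fun g hg => by
    rw [← sub_eq_zero, ← map_one π, ← map_sub, hπ]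
    exact Ideal.subset_span ⟨g, hg, rfl⟩
  let δ : H →ₐ[k] (H ⧸ I) ⊗[k] (H ⧸ I) :=
    (Algebra.TensorProduct.map π π).comp (Bialgebra.comulAlgHom k H)
  have hδ : ∀ x ∈ I, δ x = 0 := by
    intro x hx
    have hle : I ≤ RingHom.ker δ := by
      refine Ideal.span_le.2 ?_
      rintro _ ⟨g, hgl, rfl⟩
      simp [δ, RingHom.mem_ker, IsGroupLikeElem.comul_eq_tmul_self hgl, hg g hgl,
        Algebra.TensorProduct.one_def]
    exact hle hx
  have hε : ∀ x ∈ I, Bialgebra.counitAlgHom k H x = 0 := by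
    intro x hx
    have hle : I ≤ RingHom.ker (Bialgebra.counitAlgHom k H) := by
      refine Ideal.span_le.2 ?_
      rintro _ ⟨g, hgl, rfl⟩
      simp [RingHom.mem_ker, IsGroupLikeElem.counit_eq_one hgl]
    exact hle hx
  let V : Submodule k H := LinearMap.ker
    (π.toLinearMap - Algebra.linearMap k (H ⧸ I) ∘ₗ Coalgebra.counit)
  have hV : ∀ x, x ∈ V ↔ π x = algebraMap k (H ⧸ I) (Coalgebra.counit x) := by
    intro x
    simp [V, sub_eq_zero]
  have hspan : groupLikeSpan k H ≤ V := by
    rw [groupLikeSpan, Submodule.span_le]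
    intro g hgl
    rw [SetLike.mem_coe, hV, hg g hgl, IsGroupLikeElem.counit_eq_one hgl, map_one]
  suffices hmain : V = ⊤ by
    rw [← hπ, map_sub, sub_eq_zero, AlgHom.commutes]
    exact (hV h).1 (hmain ▸ Submodule.mem_top)
  refine eq_top_of_coalgebraWedge_le hH fun c hc => ?_
  -- The difference of the two sides is `(π - ηε) ⊗ (π - ηε)`, with `η` the unit map of `H ⧸ I`; it
  -- vanishes if either factor lies in `V`.
  have key := eq_of_mem_coalgebraWedge hc
    (TensorProduct.map π.toLinearMap π.toLinearMap)
    (TensorProduct.map π.toLinearMap (Algebra.linearMap k (H ⧸ I) ∘ₗ Coalgebra.counit) +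
      TensorProduct.map (Algebra.linearMap k (H ⧸ I) ∘ₗ Coalgebra.counit) π.toLinearMap -
      TensorProduct.map (Algebra.linearMap k (H ⧸ I) ∘ₗ Coalgebra.counit)
        (Algebra.linearMap k (H ⧸ I) ∘ₗ Coalgebra.counit)) ?_ ?_
  · set y : H := c - algebraMap k H (Coalgebra.counit c) with hy
    have hδy : δ y = π y ⊗ₜ[k] (1 : H ⧸ I) + (1 : H ⧸ I) ⊗ₜ[k] π y := by
      let η := Algebra.linearMap k (H ⧸ I)
      let ε : H →ₗ[k] k := Coalgebra.counit
      have h1 : TensorProduct.map π.toLinearMap (η ∘ₗ ε) =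
          TensorProduct.map π.toLinearMap η ∘ₗ LinearMap.lTensor H ε := by
        ext; simp
      have h2 : TensorProduct.map (η ∘ₗ ε) π.toLinearMap =
          TensorProduct.map η π.toLinearMap ∘ₗ LinearMap.rTensor H ε := by
        ext; simp
      have h3 : TensorProduct.map (η ∘ₗ ε) (η ∘ₗ ε) =
          TensorProduct.map η (η ∘ₗ ε) ∘ₗ LinearMap.rTensor H ε := by
        ext; simp
      have hδc : δ c = TensorProduct.map π.toLinearMap π.toLinearMap (Coalgebra.comul c) := rfl
      rw [LinearMap.sub_apply, LinearMap.add_apply, h1, h2, h3, LinearMap.comp_apply,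
        LinearMap.comp_apply, LinearMap.comp_apply, Coalgebra.lTensor_counit_comul,
        Coalgebra.rTensor_counit_comul, ← hδc] at key
      rw [hy, map_sub, map_sub, key, AlgHom.commutes, AlgHom.commutes]
      simp only [η, ε, TensorProduct.map_tmul, TensorProduct.sub_tmul, TensorProduct.tmul_sub,
        AlgHom.toLinearMap_apply, Algebra.linearMap_apply,
        map_one, LinearMap.comp_apply, Algebra.algebraMap_eq_smul_one, TensorProduct.tmul_smul,
        Algebra.TensorProduct.one_def, ← TensorProduct.smul_tmul']
      abel
    have hεy : Coalgebra.counit (R := k) y = 0 := by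
      simp [hy]
    -- The minimal polynomial of `π y` takes `y` into `I`, which `δ` kills; so it also annihilates
    -- the primitive form `δ y`.
    obtain ⟨r, hr⟩ := mem_range_algebraMap_of_aeval_primitive_eq_zero (k := k) (z := π y) (by
      rw [← hδy, Polynomial.aeval_algHom_apply]
      refine hδ _ ((hπ _).1 ?_)
      rw [← Polynomial.aeval_algHom_apply, minpoly.aeval])
    have hyr : y - algebraMap k H r ∈ I := by
      rw [← hπ, map_sub, ← hr, AlgHom.commutes, sub_self]
    have hr0 : r = 0 := by
      have := hε _ hyr
      simpa [hεy] using this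
    rw [hV, ← sub_eq_zero, ← AlgHom.commutes π, ← map_sub, ← hy, ← hr, hr0, map_zero]
  · intro u hu x
    have := (hV u).1 (hspan hu)
    simp [this]
  · intro x v hv
    have := (hV v).1 hv
    simp [this]

/-- The annihilator of a `G`-fixed element is an ideal containing every `g - 1`, hence every `h -
ε(h)`. -/
theorem groupLikeInvariants_le_of_commutative {k H A : Type*} [Field k] [CharZero k] [CommRing H]
    [HopfAlgebra k H] [FiniteDimensional k H] (hH : IsPointedCoalgebra k H) [CommRing A]
    [Algebra k A] [Module H A] [IsScalarTower k H A] [IsHopfModuleAlgebra k H A] :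
    groupLikeInvariants k H A ≤ hopfInvariants k H A := by
  intro a ha h
  have hle : Ideal.span ((fun g : H => g - 1) '' {g | IsGroupLikeElem k g}) ≤
      LinearMap.ker (LinearMap.toSpanSingleton H A a) := by
    refine Ideal.span_le.2 ?_
    rintro _ ⟨g, hg, rfl⟩
    simp [sub_smul, ha g hg]
  have := hle (sub_counit_mem_span hH h)
  rwa [LinearMap.mem_ker, LinearMap.toSpanSingleton_apply, sub_smul, sub_eq_zero,
    algebraMap_smul] at this

end CommutativeHopf

/-! ### Actions on domains in characteristic zero -/

section Domain

/-- The linear map `x ⊗ y ↦ x • (b * S(y) • a)`. -/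
noncomputable def twistedAct (k : Type*) {H A : Type*} [Field k] [Ring H] [HopfAlgebra k H]
    [CommRing A] [Algebra k A] [Module H A] [IsScalarTower k H A] (b a : A) : H ⊗[k] H →ₗ[k] A :=
  TensorProduct.lift (LinearMap.mk₂ k (fun x y : H => x • (b * (HopfAlgebra.antipode k y • a)))
    (fun x x' y => add_smul x x' _)
    (fun c x y => smul_assoc c x _)
    (fun x y y' => by rw [map_add, add_smul, mul_add, smul_add])
    (fun c x y => by rw [map_smul, smul_assoc, mul_smul_comm, smul_scalar_smul]))

theorem twistedAct_tmul {k H A : Type*} [Field k] [Ring H] [HopfAlgebra k H]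
    [CommRing A] [Algebra k A] [Module H A] [IsScalarTower k H A] (b a : A) (x y : H) :
    twistedAct k b a (x ⊗ₜ[k] y) = x • (b * (HopfAlgebra.antipode k y • a)) := rfl

variable {k H A : Type*} [Field k] [Ring H] [HopfAlgebra k H] [CommRing A] [Algebra k A]
  [Module H A] [IsScalarTower k H A] [IsHopfModuleAlgebra k H A]

/-- `∑ x₁ (b * S(x₂) a) = (x b) * a`. -/
theorem twistedAct_comul (b a : A) (x : H) :
    twistedAct k b a (Coalgebra.comul x) = (x • b) * a := by
  let act (c : A) : H →ₗ[k] A := (LinearMap.toSpanSingleton H A c).restrictScalars k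
  -- `Ψ` sends `p ⊗ q ⊗ r` to `(p b) (q S(r) a)`. Coassociativity lets the iterated coproduct be
  -- taken on the right, where `∑ q₁ S(q₂) = ε(q)` collapses it.
  let Ψ : H ⊗[k] (H ⊗[k] H) →ₗ[k] A := LinearMap.mul' k A ∘ₗ TensorProduct.map (act b)
    (act a ∘ₗ LinearMap.mul' k H ∘ₗ LinearMap.lTensor H (HopfAlgebra.antipode k))
  have hΨ : ∀ p q r : H, Ψ (p ⊗ₜ (q ⊗ₜ r)) = (p • b) * ((q * HopfAlgebra.antipode k r) • a) :=
    fun p q r => rfl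
  have h1 : Ψ ∘ₗ LinearMap.lTensor H Coalgebra.comul = LinearMap.mul' k A ∘ₗ
      TensorProduct.map (act b) (act a ∘ₗ Algebra.linearMap k H) ∘ₗ
        LinearMap.lTensor H Coalgebra.counit := by
    ext p q
    change (p • b) * (LinearMap.mul' k H ((HopfAlgebra.antipode k).lTensor H
      (Coalgebra.comul q)) • a) = (p • b) * (algebraMap k H (Coalgebra.counit q) • a)
    rw [HopfAlgebra.mul_antipode_lTensor_comul_apply]
  have h2 : Ψ ∘ₗ (TensorProduct.assoc k H H H).toLinearMap ∘ₗ LinearMap.rTensor H Coalgebra.comul =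
      twistedAct k b a := by
    refine TensorProduct.ext' fun p q => ?_
    rw [twistedAct_tmul, IsHopfModuleAlgebra.smul_mul (k := k)]
    change Ψ (TensorProduct.assoc k H H H (Coalgebra.comul p ⊗ₜ q)) = _
    induction Coalgebra.comul (R := k) p with
    | zero => simp
    | add u w hu hw => rw [TensorProduct.add_tmul, map_add, map_add, map_add, hu, hw]
    | tmul u w => rw [TensorProduct.assoc_tmul, hΨ, tensorAct_tmul, mul_smul]
  rw [← h2]
  change Ψ (TensorProduct.assoc k H H H (LinearMap.rTensor H Coalgebra.comul
    (Coalgebra.comul x))) = _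
  rw [Coalgebra.coassoc_apply, ← LinearMap.comp_apply, h1, LinearMap.comp_apply,
    LinearMap.comp_apply, Coalgebra.lTensor_counit_comul]
  change (x • b) * (algebraMap k H 1 • a) = _
  rw [map_one, one_smul]

/-- The relations `b` with `∑ b i * (h v i) = 0` for all `h` are stable under the action of `H`. -/
theorem sum_smul_mul_smul_eq_zero (k : Type*) {H A ι : Type*} [Field k] [Ring H]
    [HopfAlgebra k H] [CommRing A] [Algebra k A] [Module H A] [IsScalarTower k H A]
    [IsHopfModuleAlgebra k H A] [Fintype ι] {v b : ι → A}
    (hb : ∀ h : H, ∑ i, b i * (h • v i) = 0) (x h : H) :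
    ∑ i, (x • b i) * (h • v i) = 0 := by
  have hzero : ∑ i, twistedAct k (H := H) (b i) (h • v i) = 0 := by
    refine TensorProduct.ext' fun x y => ?_
    simp only [LinearMap.sum_apply, twistedAct_tmul, LinearMap.zero_apply, smul_smul,
      ← Finset.smul_sum, hb, smul_zero]
  have := LinearMap.congr_fun hzero (Coalgebra.comul x)
  simpa only [LinearMap.sum_apply, twistedAct_comul, LinearMap.zero_apply] using this

variable (k H) in
/-- A product over the nontrivial group-likes completes `b` to an element fixed by all of them. -/
theorem exists_mul_mem_groupLikeInvariants [FiniteDimensional k H] [IsDomain A] {b : A}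
    (hb : b ≠ 0) : ∃ t : A, t ≠ 0 ∧ t * b ∈ groupLikeInvariants k H A := by
  classical
  let _ := groupLikeAction k H A
  have : Finite (GroupLike k H) := (linearIndep_groupLikeVal (R := k) (A := H)).finite
  have := Fintype.ofFinite (GroupLike k H)
  have hne : ∀ g : GroupLike k H, g • b ≠ 0 := fun g hg => hb (by
    rw [← inv_smul_smul g b, hg, smul_zero])
  refine ⟨∏ g ∈ Finset.univ.erase (1 : GroupLike k H), g • b,
    Finset.prod_ne_zero_iff.2 fun g _ => hne g, fun g hg => ?_⟩
  have : (∏ g ∈ Finset.univ.erase (1 : GroupLike k H), g • b) * b = ∏ g : GroupLike k H, g • b := by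
    rw [← Finset.prod_erase_mul _ _ (Finset.mem_univ (1 : GroupLike k H)), one_smul]
  rw [this]
  exact Finset.smul_prod_perm b (⟨g, hg⟩ : GroupLike k H)

/-- Elements `v i` that outnumber the dimension of `H` satisfy a relation all of whose coefficients
are proportional, over the fixed field of `H`, to one of them. -/
theorem exists_relation_proportional [FiniteDimensional k H] [IsDomain A] {n : ℕ}
    (hn : Module.finrank k H < n) (v : Fin n → A) :
    ∃ b : Fin n → A, ∃ j, b j ≠ 0 ∧ ∑ i, b i * v i = 0 ∧
      ∀ (h : H) (i), b j * (h • b i) = (h • b j) * b i := by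
  classical
  let L (b : Fin n → A) : Prop := ∀ h : H, ∑ i, b i * (h • v i) = 0
  let s (b : Fin n → A) : Finset (Fin n) := Finset.univ.filter fun i => b i ≠ 0
  have hex : ∃ b : Fin n → A, L b ∧ b ≠ 0 := by
    let e := Module.finBasis k H
    let φ : (Fin n → A) →ₗ[A] (Fin (Module.finrank k H) → A) :=
      LinearMap.pi fun j => ∑ i, (e j • v i) • LinearMap.proj i
    have hφ : ¬ Function.Injective φ := fun hinj => by
      have := LinearMap.finrank_le_finrank_of_injective hinj
      simp only [Module.finrank_fin_fun] at this
      omega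
    obtain ⟨b, hb, hb0⟩ : ∃ b, φ b = 0 ∧ b ≠ 0 := by
      rw [← LinearMap.ker_eq_bot, ← ne_eq, Submodule.ne_bot_iff] at hφ
      exact hφ
    refine ⟨b, fun h => ?_, hb0⟩
    let χ : H →ₗ[k] A := ∑ i, LinearMap.mulLeft k (b i) ∘ₗ
      (LinearMap.toSpanSingleton H A (v i)).restrictScalars k
    have hχ : χ = 0 := e.ext fun j => by
      have := congrFun hb j
      simpa [φ, χ, mul_comm] using this
    have := congrArg (fun ψ => ψ h) hχ
    simpa [χ] using this
  obtain ⟨b, ⟨hbL, hb0⟩, hmin⟩ := exists_minimalFor_of_wellFoundedLT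
    (fun b : Fin n → A => L b ∧ b ≠ 0) (fun b => (s b).card) hex
  obtain ⟨j, hj⟩ : ∃ j, b j ≠ 0 := Function.ne_iff.1 hb0
  refine ⟨b, j, hj, by simpa using hbL 1, fun h => ?_⟩
  -- By stability under `H`, `c` is again a relation. Its `j`-th entry cancels, so minimality of the
  -- support of `b` forces `c = 0`.
  let c : Fin n → A := fun i => b j * (h • b i) - (h • b j) * b i
  have hcL : L c := fun x => by
    simp only [c, sub_mul, Finset.sum_sub_distrib, mul_assoc, ← Finset.mul_sum, hbL x,
      sum_smul_mul_smul_eq_zero k hbL h x, mul_zero, sub_zero]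
  have hss : s c ⊂ s b := by
    refine (Finset.ssubset_iff_of_subset fun i hi => ?_).2 ⟨j, by simpa [s] using hj, by
      simp [s, c, mul_comm]⟩
    simp only [s, Finset.mem_filter, Finset.mem_univ, true_and] at hi ⊢
    exact fun hbi => hi (by simp [c, hbi])
  by_contra! hcon
  obtain ⟨i, hi⟩ := hcon
  have hc0 : c ≠ 0 := fun h0 => hi (sub_eq_zero.1 (congrFun h0 i))
  exact (Finset.card_lt_card hss).not_ge (hmin ⟨hcL, hc0⟩ (Finset.card_lt_card hss).le)

/-- A derivation-like map kills any element that satisfies a nontrivial polynomial relation with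
coefficients proportional, over the constants, to a fixed `s`. -/
theorem derivation_eq_zero_of_relation [IsDomain A] [CharZero A] (D : A →+ A) {v s : A}
    (hs : s ≠ 0) {S : Set A} (hD : ∀ c ∈ S, ∀ n : ℕ,
      D (c * v ^ n) = D c * v ^ n + c * (n * v ^ (n - 1)) * D v)
    (hS : ∀ c ∈ S, s * D c = D s * c) (hSmul : ∀ c ∈ S, ∀ n : ℕ, c * (n + 1 : A) ∈ S)
    {Q : Polynomial A} (hQ0 : Q ≠ 0) (hQ : ∀ n, Q.coeff n ∈ S) (hQv : Q.eval v = 0) :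
    D v = 0 := by
  by_contra hDv
  obtain ⟨d, hd⟩ : ∃ d, Q.natDegree = d := ⟨_, rfl⟩
  induction d using Nat.strong_induction_on generalizing Q with
  | _ d ih =>
  by_cases hd0 : Q.natDegree = 0
  · rw [Polynomial.eq_C_of_natDegree_eq_zero hd0, Polynomial.eval_C] at hQv
    exact hQ0 (by rw [Polynomial.eq_C_of_natDegree_eq_zero hd0, hQv, map_zero])
  -- Applying `D` to `Q(v) = 0` and multiplying by `s` leaves `s Q'(v) D v = 0`. Thus `Q'` is a
  -- relation of smaller degree, nonzero in characteristic zero, until a nonzero constant would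
  -- vanish.
  refine ih _ (hd ▸ Polynomial.natDegree_derivative_lt hd0) (Q := Polynomial.derivative Q)
    (fun h => hd0 (Polynomial.derivative_eq_zero.1 h))
    (fun n => by rw [Polynomial.coeff_derivative]; exact hSmul _ (hQ (n + 1)) n) ?_ rfl
  have hderiv : (Polynomial.derivative Q).eval v =
      ∑ n ∈ Finset.range (Q.natDegree + 1), Q.coeff n * (n * v ^ (n - 1)) := by
    rw [Polynomial.derivative_eval, Polynomial.sum_over_range _ (by simp)]
    simp only [mul_assoc]
  have h0 : s * D (Q.eval v) = D s * Q.eval v + s * (Polynomial.derivative Q).eval v * D v := by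
    rw [hderiv, Polynomial.eval_eq_sum_range, map_sum, Finset.mul_sum, Finset.mul_sum,
      Finset.mul_sum, Finset.sum_mul, ← Finset.sum_add_distrib]
    refine Finset.sum_congr rfl fun n _ => ?_
    rw [hD _ (hQ n) n, mul_add, ← mul_assoc, hS _ (hQ n)]
    ring
  rw [hQv, map_zero, mul_zero, mul_zero, zero_add] at h0
  have h1 := (mul_eq_zero.1 h0.symm).resolve_right hDv
  exact (mul_eq_zero.1 h1).resolve_left hs

/-- For `h` in the wedge, `D = h - ε(h)` is a derivation on `A^G`. The powers `1, v, …, v ^ dim H`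
outnumber `dim H`, so they satisfy a relation with proportional coefficients, which forces `D v =
0`. -/
theorem groupLikeInvariants_le_of_isDomain [CharZero k] [FiniteDimensional k H]
    (hH : IsPointedCoalgebra k H) [IsDomain A] :
    groupLikeInvariants k H A ≤ hopfInvariants k H A := by
  have : CharZero A := charZero_of_injective_algebraMap (algebraMap k A).injective
  suffices htop : trivialActors k H (groupLikeInvariants k H A : Set A) = ⊤ from fun a ha h =>
    (htop ▸ Submodule.mem_top : h ∈ trivialActors k H (groupLikeInvariants k H A : Set A)) a ha
  refine eq_top_of_coalgebraWedge_le hH fun h hh v hv => ?_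
  let D : A →+ A :=
    { toFun := fun a => h • a - Coalgebra.counit (R := k) h • a
      map_zero' := by simp
      map_add' := fun a b => by simp only [smul_add]; abel }
  have hDdef : ∀ a, D a = h • a - Coalgebra.counit (R := k) h • a := fun _ => rfl
  have hDmul : ∀ a ∈ groupLikeInvariants k H A, ∀ b ∈ groupLikeInvariants k H A,
      D (a * b) = a * D b + b * D a := fun a ha b hb => by
    have hb' : ∀ w ∈ trivialActors k H (groupLikeInvariants k H A : Set A),
        w • b = Coalgebra.counit (R := k) w • b := fun w hw => hw b hb
    simp only [hDdef]
    rw [smul_mul_of_mem_coalgebraWedge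
      (fun u hu => smul_eq_counit_smul_of_mem_groupLikeSpan ha hu) hb' hh]
    simp only [Algebra.smul_def]
    ring
  have hDpow : ∀ n : ℕ, D (v ^ n) = n * v ^ (n - 1) * D v := by
    intro n
    induction n with
    | zero => simp [hDdef, IsHopfModuleAlgebra.smul_one (k := k), Algebra.algebraMap_eq_smul_one]
    | succ n ih =>
      rw [pow_succ', hDmul v hv _ (pow_mem hv n), ih]
      -- The truncated exponent `n - 1` makes `v * v ^ (n - 1) = v ^ n` unavailable at `n = 0`,
      -- where the coefficient is zero instead.
      rcases n with _ | n
      · simp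
      · push_cast
        ring
  obtain ⟨b, j, hj, hsum, hb⟩ := exists_relation_proportional (k := k) (H := H)
    (Nat.lt_succ_self _) (fun i : Fin (Module.finrank k H + 1) => v ^ (i : ℕ))
  obtain ⟨t, ht0, ht⟩ := exists_mul_mem_groupLikeInvariants k H hj
  have hs0 : t * b j ≠ 0 := mul_ne_zero ht0 hj
  have hprop : ∀ (x : H) (i), (t * b j) * (x • (t * b i)) = (x • (t * b j)) * (t * b i) := by
    intro x i
    rw [IsHopfModuleAlgebra.smul_mul (k := k), IsHopfModuleAlgebra.smul_mul (k := k)]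
    induction Coalgebra.comul (R := k) x with
    | zero => simp
    | add T T' hT hT' => rw [map_add, map_add, mul_add, add_mul, hT, hT']
    | tmul p q =>
      rw [tensorAct_tmul, tensorAct_tmul]
      linear_combination t * (p • t) * hb q i
  -- Once the pivot `t * b j` is `G`-fixed, proportionality and cancellation make all the other
  -- coefficients `G`-fixed.
  have hmem : ∀ i, t * b i ∈ groupLikeInvariants k H A := fun i g hg =>
    mul_left_cancel₀ hs0 (by rw [hprop g i, ht g hg])
  let S : Set A := {c | c ∈ groupLikeInvariants k H A ∧ (t * b j) * D c = D (t * b j) * c}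
  have hnat : ∀ n : ℕ, ((n : A) + 1) ∈ groupLikeInvariants k H A := fun n =>
    add_mem (natCast_mem _ n) (one_mem _)
  have hDnat : ∀ n : ℕ, D ((n : A) + 1) = 0 := fun n => by
    have : ((n : A) + 1) = algebraMap k A (n + 1) := by simp
    rw [this, hDdef, Algebra.algebraMap_eq_smul_one, smul_scalar_smul,
      IsHopfModuleAlgebra.smul_one (k := k), Algebra.algebraMap_eq_smul_one, smul_comm, sub_self]
  let Q : Polynomial A := ∑ i : Fin (Module.finrank k H + 1),
    Polynomial.monomial (i : ℕ) (t * b i)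
  have hcoeff : ∀ i : Fin (Module.finrank k H + 1), Q.coeff i = t * b i := fun i => by
    simp [Q, Polynomial.finsetSum_coeff, Polynomial.coeff_monomial, Fin.val_inj]
  have hDv : D v = 0 := by
    refine derivation_eq_zero_of_relation D hs0 (S := S) (Q := Q) ?_ (fun c hc => hc.2) ?_ ?_ ?_ ?_
    · intro c hc n
      rw [hDmul c hc.1 _ (pow_mem hv n), hDpow]
      ring
    · intro c hc n
      refine ⟨mul_mem hc.1 (hnat n), ?_⟩
      rw [hDmul c hc.1 _ (hnat n), hDnat]
      linear_combination ((n : A) + 1) * hc.2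
    · intro h0
      exact hs0 (by rw [← hcoeff j, h0, Polynomial.coeff_zero])
    · intro n
      by_cases hn : n < Module.finrank k H + 1
      · rw [hcoeff ⟨n, hn⟩]
        refine ⟨hmem _, ?_⟩
        simp only [hDdef, Algebra.smul_def]
        linear_combination hprop h ⟨n, hn⟩
      · have : Q.coeff n = 0 := by
          rw [Polynomial.finsetSum_coeff]
          refine Finset.sum_eq_zero fun i _ => ?_
          rw [Polynomial.coeff_monomial, if_neg]
          have := i.2
          omega
        rw [this]
        exact ⟨zero_mem _, by simp⟩
    · rw [Polynomial.eval_finsetSum]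
      simp only [Polynomial.eval_monomial, mul_assoc, ← Finset.mul_sum, hsum, mul_zero]
  exact sub_eq_zero.1 hDv

end Domain

theorem theorem2p4 {k H A : Type*} [Field k]
    [Ring H] [HopfAlgebra k H] [FiniteDimensional k H] (hH : IsPointedCoalgebra k H)
    [CommRing A] [Algebra k A] [Algebra.FiniteType k A]
    [Module H A] [IsScalarTower k H A] [IsHopfModuleAlgebra k H A]
    (hyp : (∃ p : ℕ, 0 < p ∧ CharP k p) ∨ (∀ x y : H, x * y = y * x) ∨ IsDomain A) :
    Algebra.IsIntegral (hopfInvariants k H A) A := by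
  obtain ⟨p, hp⟩ := CharP.exists k
  -- Positive characteristic needs no other assumption; in characteristic zero only the last two
  -- alternatives survive.
  rcases p.eq_zero_or_pos with rfl | hpos
  · have : CharZero k := CharP.charP_to_charZero k
    refine isIntegral_hopfInvariants_of_le ?_
    rcases hyp with ⟨q, hq, hqk⟩ | hcomm | hdom
    · exact absurd (CharP.eq k hqk hp) hq.ne'
    · let _ : CommRing H := { ‹Ring H› with mul_comm := hcomm }
      exact groupLikeInvariants_le_of_commutative (k := k) (H := H) hH
    · exact groupLikeInvariants_le_of_isDomain hH
  · exact isIntegral_hopfInvariants_of_charP hH hpos
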